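/- Let $L^2=L^2(\mathbb T,m)$ and $L^\infty=L^\infty(\mathbb T,m)$, where $m$ is normalized Lebesgue measure on the unit circle $\mathbb T$, write $\widehat f(n)$ for the Fourier coefficients of $f$, and let $H^2=\{f\in L^2:\widehat f(n)=0 \text{ for all } n<0\}$ with orthogonal projection $P_{H^2}\colon L^2\to H^2$. For $\xi,\theta\in\mathbb R$ let $C_{\xi,\theta}$ be the conjugation on $H^2$ given by $$(C_{\xi,\theta}f)(z)=e^{i\xi}\,\overline{f(e^{i\theta}\bar z)}.$$ For a conjugation $C$ on a complex Hilbert space $\mathcal H$ (an antilinear map with $C^2=I$ and $\langle h,g\rangle=\langle Cg,Ch\rangle$ for all $h,g$), a bounded linear operator $N$ on $\mathcal H$ is called $C$-normal if $NC(NC)^\sharp=(NC)^\sharp NC$, where $X^\sharp$ is the antilinear adjoint of a bounded antilinear operator $X$, i.e. the antilinear operator determined by $\langle Xx,y\rangle=\overline{\langle x,X^\sharp y\rangle}$ for all $x,y\in\mathcal H$. Let $\varphi\in L^\infty$ have the Fourier expansion $\varphi(z)=\sum_{n=-\infty}^{\infty}\widehat\varphi(n)z^n$, and put $$\varphi_+(z)=\sum_{n=1}^{\infty}\widehat\varphi(n)z^n,\qquad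 \varphi_-(z)=\sum_{n=-\infty}^{-1}\widehat\varphi(n)z^n$$ (series convergent in $L^2$; thus $\varphi_+\in H^2$, $\varphi_-\in L^2$). Then the Toeplitz operator $T_\varphi\colon H^2\to H^2$, $T_\varphi f=P_{H^2}(\varphi f)$, is $C_{\xi,\theta}$-normal if and only if there is $\eta\in\mathbb C$ with $|\eta|=1$ such that, almost everywhere on $\mathbb T$, $$\varphi_-=\eta\,e^{i\xi}\,\overline{C_{\xi,\theta}\varphi_+}$$ and $$(\eta-\bar\eta)\,\varphi_+\,C_{\xi,\theta}\varphi_+ +\overline{\widehat\varphi(0)}\,(\eta-1)\,e^{i\xi}\,\varphi_+-\widehat\varphi(0)\,(\bar\eta-1)\,C_{\xi,\theta}\varphi_+=0 .$$ -/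

import Mathlib

open MeasureTheory AddCircle
open scoped ComplexConjugate ENNReal InnerProductSpace

noncomputable section

/-! ### Conjugations, antilinear adjoints and `C`-normal operators -/

section Abstract

variable {H : Type*} [NormedAddCommGroup H] [InnerProductSpace ℂ H]

/-- A conjugation on a complex inner product space: an antilinear involution `C` with
`⟨h, g⟩ = ⟨C g, C h⟩` for all `h`, `g`. -/
structure Conjugation (H : Type*) [NormedAddCommGroup H] [InnerProductSpace ℂ H] where
  toCLM : H →L⋆[ℂ] H
  involutive : ∀ h, toCLM (toCLM h) = h
  inner_swap : ∀ h g, ⟪toCLM g, toCLM h⟫_ℂ = ⟪h, g⟫_ℂ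

instance : CoeFun (Conjugation H) (fun _ => H → H) := ⟨fun C => C.toCLM⟩

variable [CompleteSpace H]

/-- The antilinear adjoint `X♯` of a bounded antilinear operator `X`: the vector `X♯ y` is the
Riesz representative of the (linear) functional `x ↦ ⟪X x, y⟫`. -/
def antilinearAdjoint (X : H →L⋆[ℂ] H) : H →L⋆[ℂ] H :=
  LinearMap.mkContinuous
    { toFun := fun y => (InnerProductSpace.toDual ℂ H).symm (((innerSL ℂ).flip y).comp X)
      map_add' := fun y z => by
        rw [← map_add]
        congr 1
        ext x
        simp
      map_smul' := fun c y => by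
        rw [← map_smulₛₗ]
        congr 1
        ext x
        simp }
    ‖X‖ (fun y => by
      change ‖(InnerProductSpace.toDual ℂ H).symm (((innerSL ℂ).flip y).comp X)‖ ≤ _
      rw [LinearIsometryEquiv.norm_map]
      refine ContinuousLinearMap.opNorm_le_bound _ (by positivity) fun x => ?_
      have h1 := norm_inner_le_norm (𝕜 := ℂ) (X x) y
      have h2 := X.le_opNorm x
      have h3 : ‖X x‖ * ‖y‖ ≤ ‖X‖ * ‖x‖ * ‖y‖ := by gcongr
      have h4 : ‖X‖ * ‖y‖ * ‖x‖ = ‖X‖ * ‖x‖ * ‖y‖ := by ring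
      rw [h4]
      exact h1.trans h3)

/-- The defining identity of the antilinear adjoint, `⟨X x, y⟩ = conj ⟨x, X♯ y⟩`. (Mathlib's inner
product is antilinear in its first argument, so `⟨a, b⟩` is `⟪b, a⟫_ℂ`.) -/
theorem inner_antilinearAdjoint (X : H →L⋆[ℂ] H) (x y : H) :
    ⟪y, X x⟫_ℂ = conj ⟪antilinearAdjoint X y, x⟫_ℂ := by
  have h : ⟪antilinearAdjoint X y, x⟫_ℂ = ⟪X x, y⟫_ℂ := by
    change ⟪(InnerProductSpace.toDual ℂ H).symm (((innerSL ℂ).flip y).comp X), x⟫_ℂ = _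
    rw [InnerProductSpace.toDual_symm_apply]
    simp
  rw [h, inner_conj_symm]

/-- A bounded operator `N` is `C`-normal if `N C (N C)♯ = (N C)♯ (N C)`. -/
def IsCNormal (C : Conjugation H) (N : H →L[ℂ] H) : Prop :=
  (N.comp C.toCLM).comp (antilinearAdjoint (N.comp C.toCLM)) =
    (antilinearAdjoint (N.comp C.toCLM)).comp (N.comp C.toCLM)

end Abstract

/-! ### The unit circle, `L²`, `L^∞` and the Hardy space `H²`

The unit circle is Mathlib's `AddCircle (2 * π)`, the point `z = e^{it}` being the class of `t`,
with normalized Lebesgue measure `haarAddCircle`; the function `z ^ n` is `fourier n`. -/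

instance fact_two_pi_pos : Fact (0 < 2 * Real.pi) := ⟨Real.two_pi_pos⟩

/-- The unit circle; the class of `t` stands for `z = e^{it}`. -/
abbrev Torus : Type := AddCircle (2 * Real.pi)

/-- The space `L²` of the circle. -/
abbrev L2Torus : Type := Lp ℂ 2 (haarAddCircle : Measure Torus)

/-- The space `L^∞` of the circle. -/
abbrev LinfTorus : Type := Lp ℂ ∞ (haarAddCircle : Measure Torus)

theorem memLp_two_of_Linf (φ : LinfTorus) : MemLp φ 2 (haarAddCircle : Measure Torus) :=
  (Lp.memLp φ).mono_exponent le_top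

theorem toCircle_sub_eq (θ : ℝ) (t : Torus) :
    (AddCircle.toCircle ((θ : Torus) - t) : ℂ) =
      Complex.exp (θ * Complex.I) * conj (AddCircle.toCircle t : ℂ) := by
  rw [sub_eq_add_neg, AddCircle.toCircle_add, AddCircle.toCircle_neg, AddCircle.toCircle_apply_mk,
    Circle.coe_mul, Circle.coe_inv_eq_conj, Circle.coe_exp]
  congr 3
  have := Real.pi_ne_zero
  push_cast
  field_simp

/-- The Hardy space `H²`: all `f ∈ L²` whose negative Fourier coefficients vanish. -/
def Hardy : Submodule ℂ L2Torus where
  carrier := {f | ∀ n : ℤ, n < 0 → fourierCoeff f n = 0}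
  add_mem' := fun {f g} hf hg n hn => by
    rw [← fourierBasis_repr, map_add, lp.coeFn_add, Pi.add_apply, fourierBasis_repr,
      fourierBasis_repr, hf n hn, hg n hn, add_zero]
  zero_mem' := fun n _ => by
    rw [← fourierBasis_repr, map_zero, lp.coeFn_zero, Pi.zero_apply]
  smul_mem' := fun c f hf n hn => by
    rw [← fourierBasis_repr, map_smul, lp.coeFn_smul, Pi.smul_apply, fourierBasis_repr,
      hf n hn, smul_zero]

theorem mem_Hardy_iff (f : L2Torus) :
    f ∈ Hardy ↔ ∀ n : ℤ, n < 0 → fourierCoeff f n = 0 := Iff.rfl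

theorem isClosed_Hardy : IsClosed (Hardy : Set L2Torus) := by
  have h : (Hardy : Set L2Torus) =
      ⋂ n : ℤ, ⋂ _ : n < 0, {f : L2Torus | ⟪(fourierLp 2 n : L2Torus), f⟫_ℂ = 0} := by
    ext f
    simp only [SetLike.mem_coe, mem_Hardy_iff, Set.mem_iInter, Set.mem_ofPred_eq]
    refine forall_congr' fun n => forall_congr' fun _ => ?_
    rw [← fourierBasis_repr, HilbertBasis.repr_apply_apply, coe_fourierBasis]
  rw [h]
  refine isClosed_iInter fun n => isClosed_iInter fun _ => ?_
  exact isClosed_eq (by fun_prop) continuous_const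

instance completeSpace_Hardy : CompleteSpace Hardy :=
  isClosed_Hardy.completeSpace_coe

/-! ### Toeplitz operators -/

/-- Multiplication by `φ ∈ L^∞` as a bounded operator on `L²`. -/
def mulOp (φ : LinfTorus) : L2Torus →L[ℂ] L2Torus :=
  (ContinuousLinearMap.mul ℂ ℂ).holderL haarAddCircle ∞ 2 2 φ

theorem coeFn_mulOp (φ : LinfTorus) (f : L2Torus) :
    mulOp φ f =ᵐ[haarAddCircle] fun t => φ t * f t :=
  (ContinuousLinearMap.mul ℂ ℂ).coeFn_holder φ f

/-- The Toeplitz operator `T_φ f = P_{H²} (φ f)` on `H²`. -/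
def toeplitz (φ : LinfTorus) : Hardy →L[ℂ] Hardy :=
  Hardy.orthogonalProjectionOnto.comp ((mulOp φ).comp Hardy.subtypeL)

/-! ### The conjugation `C_{ξ,θ}` -/

theorem measurePreserving_reflect (θ : ℝ) :
    MeasurePreserving (fun t : Torus => (θ : Torus) - t) haarAddCircle haarAddCircle :=
  Measure.measurePreserving_sub_left haarAddCircle (θ : Torus)

/-- The function `z ↦ e^{iξ} conj (f (e^{iθ} conj z))` for `f ∈ L²`. -/
def conjFun (ξ θ : ℝ) (f : L2Torus) : L2Torus :=
  Complex.exp (ξ * Complex.I) •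
    star (Lp.compMeasurePreserving (fun t : Torus => (θ : Torus) - t)
      (measurePreserving_reflect θ) f)

theorem coeFn_conjFun (ξ θ : ℝ) (f : L2Torus) :
    conjFun ξ θ f =ᵐ[haarAddCircle]
      fun t => Complex.exp (ξ * Complex.I) * conj (f ((θ : Torus) - t)) := by
  have h1 := Lp.coeFn_smul (Complex.exp (ξ * Complex.I))
    (star (Lp.compMeasurePreserving (fun t : Torus => (θ : Torus) - t)
      (measurePreserving_reflect θ) f))
  have h2 := Lp.coeFn_star (Lp.compMeasurePreserving (fun t : Torus => (θ : Torus) - t)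
      (measurePreserving_reflect θ) f)
  have h3 := Lp.coeFn_compMeasurePreserving f (measurePreserving_reflect θ)
  filter_upwards [h1, h2, h3] with t e1 e2 e3
  rw [conjFun, e1, Pi.smul_apply, e2, Pi.star_apply, e3]
  rfl

theorem fourierCoeff_conjFun (ξ θ : ℝ) (f : L2Torus) (n : ℤ) :
    fourierCoeff (conjFun ξ θ f) n =
      Complex.exp (ξ * Complex.I) * conj (fourier n (θ : Torus)) * conj (fourierCoeff f n) := by
  rw [fourierCoeff_congr_ae (coeFn_conjFun ξ θ f), fourierCoeff.const_mul, mul_assoc]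
  congr 1
  rw [fourierCoeff, fourierCoeff, ← integral_conj, ← integral_const_mul,
    ← integral_sub_left_eq_self _ (haarAddCircle : Measure Torus) (θ : Torus)]
  refine integral_congr_ae (Filter.Eventually.of_forall fun t => ?_)
  simp only [smul_eq_mul, sub_sub_cancel, map_mul]
  rw [fourier_neg, fourier_neg, Complex.conj_conj, sub_eq_add_neg, ← mul_assoc]
  congr 1
  simp only [fourier_apply, smul_add, smul_neg, AddCircle.toCircle_add, AddCircle.toCircle_neg,
    Circle.coe_mul, Circle.coe_inv_eq_conj, map_mul, Complex.conj_conj]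

theorem conjFun_mem_Hardy (ξ θ : ℝ) {f : L2Torus} (hf : f ∈ Hardy) : conjFun ξ θ f ∈ Hardy := by
  intro n hn
  rw [fourierCoeff_conjFun, hf n hn, map_zero, mul_zero]

theorem conjFun_add (ξ θ : ℝ) (f g : L2Torus) :
    conjFun ξ θ (f + g) = conjFun ξ θ f + conjFun ξ θ g := by
  have h4 := (measurePreserving_reflect θ).quasiMeasurePreserving.ae (Lp.coeFn_add f g)
  refine Lp.ext ?_
  filter_upwards [coeFn_conjFun ξ θ (f + g), coeFn_conjFun ξ θ f, coeFn_conjFun ξ θ g,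
    Lp.coeFn_add (conjFun ξ θ f) (conjFun ξ θ g), h4] with t e1 e2 e3 e4 e5
  rw [e1, e4, Pi.add_apply, e2, e3, e5, Pi.add_apply, map_add, mul_add]

theorem conjFun_smul (ξ θ : ℝ) (c : ℂ) (f : L2Torus) :
    conjFun ξ θ (c • f) = conj c • conjFun ξ θ f := by
  have h4 := (measurePreserving_reflect θ).quasiMeasurePreserving.ae (Lp.coeFn_smul c f)
  refine Lp.ext ?_
  filter_upwards [coeFn_conjFun ξ θ (c • f), coeFn_conjFun ξ θ f,
    Lp.coeFn_smul (conj c) (conjFun ξ θ f), h4] with t e1 e2 e3 e4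
  rw [e1, e3, Pi.smul_apply, e2, e4, Pi.smul_apply, smul_eq_mul, smul_eq_mul, map_mul]
  ring

theorem conj_exp_mul_exp (ξ : ℝ) :
    conj (Complex.exp (ξ * Complex.I)) * Complex.exp (ξ * Complex.I) = 1 := by
  rw [← Complex.exp_conj, ← Complex.exp_add]
  simp

theorem conjFun_conjFun (ξ θ : ℝ) (f : L2Torus) : conjFun ξ θ (conjFun ξ θ f) = f := by
  have h4 := (measurePreserving_reflect θ).quasiMeasurePreserving.ae (coeFn_conjFun ξ θ f)
  refine Lp.ext ?_
  filter_upwards [coeFn_conjFun ξ θ (conjFun ξ θ f), h4] with t e1 e2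
  rw [e1, e2, sub_sub_cancel, map_mul, Complex.conj_conj, ← mul_assoc, mul_comm (Complex.exp _),
    conj_exp_mul_exp, one_mul]

theorem inner_conjFun (ξ θ : ℝ) (f g : L2Torus) :
    ⟪conjFun ξ θ g, conjFun ξ θ f⟫_ℂ = ⟪f, g⟫_ℂ := by
  rw [L2.inner_def, L2.inner_def,
    ← integral_sub_left_eq_self (fun t => ⟪f t, g t⟫_ℂ) (haarAddCircle : Measure Torus) (θ : Torus)]
  refine integral_congr_ae ?_
  filter_upwards [coeFn_conjFun ξ θ f, coeFn_conjFun ξ θ g] with t e1 e2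
  have h := conj_exp_mul_exp ξ
  rw [e1, e2]
  simp only [RCLike.inner_apply, map_mul, Complex.conj_conj]
  linear_combination (conj (f ((θ : Torus) - t)) * g ((θ : Torus) - t)) * h

/-- The conjugation `C_{ξ,θ}` on `H²`, `(C_{ξ,θ} f)(z) = e^{iξ} conj (f (e^{iθ} conj z))`. -/
def hardyConj (ξ θ : ℝ) : Conjugation Hardy where
  toCLM := LinearMap.mkContinuous
    { toFun := fun f => ⟨conjFun ξ θ f, conjFun_mem_Hardy ξ θ f.2⟩
      map_add' := fun f g => Subtype.ext (conjFun_add ξ θ f g)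
      map_smul' := fun c f => Subtype.ext (conjFun_smul ξ θ c f) }
    1 (fun f => by
      change ‖conjFun ξ θ f‖ ≤ 1 * ‖(f : L2Torus)‖
      rw [one_mul]
      refine le_of_eq ?_
      rw [@norm_eq_sqrt_re_inner ℂ, inner_conjFun, ← norm_eq_sqrt_re_inner])
  involutive := fun f => Subtype.ext (conjFun_conjFun ξ θ f)
  inner_swap := fun f g => inner_conjFun ξ θ f g

theorem coe_hardyConj (ξ θ : ℝ) (f : Hardy) :
    (hardyConj ξ θ f : L2Torus) = conjFun ξ θ f := rfl

theorem coeFn_hardyConj (ξ θ : ℝ) (f : Hardy) :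
    (hardyConj ξ θ f : L2Torus) =ᵐ[haarAddCircle]
      fun t => Complex.exp (ξ * Complex.I) * conj ((f : L2Torus) ((θ : Torus) - t)) :=
  coeFn_conjFun ξ θ f

/-! ### The analytic and coanalytic parts of a symbol -/

theorem hasSum_symbol (φ : LinfTorus) :
    HasSum (fun n : ℤ => fourierCoeff φ n • (fourierLp 2 n : L2Torus))
      ((memLp_two_of_Linf φ).toLp φ) := by
  have h := hasSum_fourier_series_L2 ((memLp_two_of_Linf φ).toLp φ)
  rwa [fourierCoeff_congr_ae (memLp_two_of_Linf φ).coeFn_toLp] at h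

theorem fourierLp_mem_Hardy (k : ℕ) : (fourierLp 2 (k : ℤ) : L2Torus) ∈ Hardy := by
  intro n hn
  rw [← fourierBasis_repr, HilbertBasis.repr_apply_apply, coe_fourierBasis]
  exact orthonormal_fourier.2 (by omega)

/-- The basis element `e_k(z) = z ^ k` of `H²`. -/
def hardyMonomial (k : ℕ) : Hardy := ⟨fourierLp 2 (k : ℤ), fourierLp_mem_Hardy k⟩

/-- `φ₊ = ∑_{n ≥ 1} φ̂(n) z ^ n`, as an element of `H²` (the series converges in norm). -/
def plusPart (φ : LinfTorus) : Hardy :=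
  ∑' k : ℕ, fourierCoeff φ ((k + 1 : ℕ) : ℤ) • hardyMonomial (k + 1)

/-- `φ₋ = ∑_{n ≤ -1} φ̂(n) z ^ n`, as an element of `L²` (the series converges in norm). -/
def minusPart (φ : LinfTorus) : L2Torus :=
  ∑' k : ℕ, fourierCoeff φ (-((k + 1 : ℕ) : ℤ)) • (fourierLp 2 (-((k + 1 : ℕ) : ℤ)) : L2Torus)

theorem hasSum_minusPart (φ : LinfTorus) :
    HasSum (fun k : ℕ => fourierCoeff φ (-((k + 1 : ℕ) : ℤ)) •
      (fourierLp 2 (-((k + 1 : ℕ) : ℤ)) : L2Torus)) (minusPart φ) := by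
  refine Summable.hasSum ?_
  exact (hasSum_symbol φ).summable.comp_injective (i := fun k : ℕ => -((k + 1 : ℕ) : ℤ))
    (fun a b h => by simp only at h; omega)

theorem hasSum_plusPart (φ : LinfTorus) :
    HasSum (fun k : ℕ => fourierCoeff φ ((k + 1 : ℕ) : ℤ) • hardyMonomial (k + 1))
      (plusPart φ) := by
  have hs : Summable (fun k : ℕ => fourierCoeff φ ((k + 1 : ℕ) : ℤ) •
      (fourierLp 2 ((k + 1 : ℕ) : ℤ) : L2Torus)) :=
    (hasSum_symbol φ).summable.comp_injective (i := fun k : ℕ => ((k + 1 : ℕ) : ℤ))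
      (fun a b h => by simp only at h; omega)
  obtain ⟨a, ha⟩ := hs
  have hmem : a ∈ Hardy := isClosed_Hardy.mem_of_tendsto ha
    (Filter.Eventually.of_forall fun s => Hardy.sum_mem fun k _ =>
      Hardy.smul_mem _ (fourierLp_mem_Hardy (k + 1)))
  refine Summable.hasSum ⟨⟨a, hmem⟩, ?_⟩
  refine (Topology.IsInducing.subtypeVal.hasSum_iff (g := Hardy.subtype) _ _).1 ?_
  exact ha

end

/-! ### Sequences -/

/-! Write a n for the Fourier coefficients of φ and u n = e^{inθ}. On monomials C is diagonal with
unimodular entries, so normality of X = T_φ C becomes equality, for all i, j ≥ 0, of the Gram sums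
of a and of the reflected sequence b n = u (-n) a (-n) (`isCNormal_toeplitz_iff`).

Toeplitz structure makes these sums telescope: moving (i, j) to (i+1, j+1) adds the single product
conj (a (i+1)) a (j+1). Equality therefore splits into equality of two rank-one matrices and
equality of the first rows (`toeplitzGram_eq_iff`). The first says b m = η a m for m ≥ 1 with |η| =
1, which is the formula for φ₋. Given this, the infinite tails of the first rows cancel, and what
remains is a finite convolution identity for each i (`toeplitzGram_twist_eq_iff`). Up to the factor
e^{iξ} it is the i-th Fourier coefficient of the second equation. As φ₊ · Cφ₊ is only known to be
integrable, the return to functions uses uniqueness of Fourier coefficients in L¹. -/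

theorem exists_unimodular_of_conj_mul_eq {ι : Type*} {x y : ι → ℂ}
    (h : ∀ i j, conj (x i) * x j = conj (y i) * y j) :
    ∃ η : ℂ, ‖η‖ = 1 ∧ ∀ i, y i = η * x i := by
  have hn (i : ι) : ‖x i‖ = ‖y i‖ := by
    have := h i i
    rw [Complex.conj_mul', Complex.conj_mul'] at this
    exact (pow_left_inj₀ (norm_nonneg _) (norm_nonneg _) two_ne_zero).1 (by exact_mod_cast this)
  -- If x vanishes, so does y, and any unimodular η serves; otherwise η is read off at one nonzero
  -- entry.
  by_cases hx : ∀ i, x i = 0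
  · refine ⟨1, norm_one, fun i => ?_⟩
    rw [hx i, mul_zero, ← norm_eq_zero, ← hn i, hx i, norm_zero]
  · push Not at hx
    obtain ⟨i, hi⟩ := hx
    refine ⟨y i / x i, ?_, fun j => ?_⟩
    · rw [norm_div, hn i, div_self]
      rw [← hn i]
      exact norm_ne_zero_iff.2 hi
    · have h1 := h i i
      have h2 := h i j
      have hc : conj (x i) ≠ 0 := (map_ne_zero _).2 hi
      field_simp
      refine mul_left_cancel₀ hc ?_
      linear_combination y j * h1 - y i * h2

theorem summable_conj_mul_of_sq {ι κ : Type*} {a : ι → ℂ} (ha : Summable fun n => ‖a n‖ ^ 2)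
    {f g : κ → ι} (hf : f.Injective) (hg : g.Injective) :
    Summable fun k => conj (a (f k)) * a (g k) := by
  refine Summable.of_norm_bounded ((ha.comp_injective hf).add (ha.comp_injective hg)) fun k => ?_
  rw [norm_mul, RCLike.norm_conj]
  simp only [Function.comp_apply]
  nlinarith [sq_nonneg (‖a (f k)‖ - ‖a (g k)‖), sq_nonneg ‖a (f k)‖, sq_nonneg ‖a (g k)‖]

/-- The complex conjugates of the entries of `T T*`, where `T` is the Toeplitz matrix with symbol
coefficients `a`. -/
noncomputable def toeplitzGram (a : ℤ → ℂ) (i j : ℤ) : ℂ := ∑' k : ℕ, conj (a (i - k)) * a (j - k)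

theorem summable_toeplitzGram {a : ℤ → ℂ} (ha : Summable fun n => ‖a n‖ ^ 2) (i j : ℤ) :
    Summable fun k : ℕ => conj (a (i - k)) * a (j - k) :=
  summable_conj_mul_of_sq ha (fun k l h => by omega)
    (fun k l h => by omega)

theorem toeplitzGram_add_one {a : ℤ → ℂ} (ha : Summable fun n => ‖a n‖ ^ 2) (i j : ℤ) :
    toeplitzGram a (i + 1) (j + 1) = conj (a (i + 1)) * a (j + 1) + toeplitzGram a i j := by
  rw [toeplitzGram, (summable_toeplitzGram ha _ _).tsum_eq_zero_add]
  simp [toeplitzGram]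

theorem conj_toeplitzGram (a : ℤ → ℂ) (i j : ℤ) :
    conj (toeplitzGram a i j) = toeplitzGram a j i := by
  simp only [toeplitzGram, Complex.conj_tsum, map_mul, Complex.conj_conj, mul_comm]

/-- The cut is placed after k = i so that the tail involves only coefficients of negative index. -/
theorem toeplitzGram_zero {a : ℤ → ℂ} (ha : Summable fun n => ‖a n‖ ^ 2) (i : ℕ) :
    toeplitzGram a 0 i = ∑ k ∈ Finset.range (i + 1), conj (a (-k)) * a (i - k) +
      ∑' k : ℕ, conj (a (-((k + i + 1 : ℕ) : ℤ))) * a (-((k + 1 : ℕ) : ℤ)) := by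
  rw [toeplitzGram, ← (summable_toeplitzGram ha _ _).sum_add_tsum_nat_add (i + 1)]
  congr 1
  · simp
  · refine tsum_congr fun k => ?_
    rw [zero_sub, Nat.add_assoc k i 1, show (i : ℤ) - ((k + (i + 1) : ℕ) : ℤ) = -((k + 1 : ℕ) : ℤ) by
      push_cast; ring]

/-- Diagonal differences are rank-one products, and every entry is reached diagonally from the first
row or column; Hermitian symmetry reduces the column to the row. -/
theorem toeplitzGram_eq_iff {a b : ℤ → ℂ} (ha : Summable fun n => ‖a n‖ ^ 2)
    (hb : Summable fun n => ‖b n‖ ^ 2) :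
    (∀ i j : ℕ, toeplitzGram a i j = toeplitzGram b i j) ↔
      (∀ i j : ℕ, conj (a (i + 1)) * a (j + 1) = conj (b (i + 1)) * b (j + 1)) ∧
        ∀ i : ℕ, toeplitzGram a 0 i = toeplitzGram b 0 i := by
  constructor
  · refine fun h => ⟨fun i j => ?_, fun i => by exact_mod_cast h 0 i⟩
    have h1 := h (i + 1) (j + 1)
    push_cast at h1
    rw [toeplitzGram_add_one ha, toeplitzGram_add_one hb, h i j] at h1
    exact add_right_cancel h1
  · rintro ⟨h1, h2⟩ i
    induction i with
    | zero => exact_mod_cast h2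
    | succ i ih =>
      rintro (_ | j)
      · rw [← conj_toeplitzGram a, ← conj_toeplitzGram b]
        exact congrArg conj (by exact_mod_cast h2 (i + 1))
      · push_cast
        rw [toeplitzGram_add_one ha, toeplitzGram_add_one hb, h1, ih]

/-- For the reflected and twisted sequence `b n = u (-n) a (-n)`, the Gram matrices of `a` and `b` agree
exactly when the negative coefficients of `a` are a unimodular multiple of the twisted positive
ones and a family of finite convolution identities holds. -/
theorem toeplitzGram_twist_eq_iff {a u : ℤ → ℂ} (ha : Summable fun n => ‖a n‖ ^ 2)
    (hu0 : u 0 = 1) (hu : ∀ n, u (-n) * u n = 1) (hu' : ∀ n, ‖u n‖ = 1) {p : ℤ → ℂ}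
    (hp : ∀ n, p n = if 0 < n then a n else 0) :
    (∀ i j : ℕ, toeplitzGram a i j = toeplitzGram (fun n => u (-n) * a (-n)) i j) ↔
      ∃ η : ℂ, ‖η‖ = 1 ∧ (∀ m : ℕ, a (-(m + 1)) = η * (u (m + 1) * a (m + 1))) ∧
        ∀ i : ℕ, (η - conj η) * ∑ k ∈ Finset.range (i + 1), p (i - k) * conj (u k * p k) +
          conj (a 0) * (η - 1) * p i - a 0 * (conj η - 1) * conj (u i * p i) = 0 := by
  have hb : Summable fun n => ‖u (-n) * a (-n)‖ ^ 2 := by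
    simp only [norm_mul, hu', one_mul]
    exact ha.comp_injective neg_injective
  have key (η : ℂ) (m : ℕ) : a (-(m + 1)) = η * (u (m + 1) * a (m + 1)) ↔
      u (-(m + 1)) * a (-(m + 1)) = η * a (m + 1) := by
    have h := hu (m + 1)
    constructor <;> intro h1
    · rw [h1]; linear_combination η * a (m + 1) * h
    · linear_combination u (m + 1) * h1 - a (-(m + 1)) * h
  have main {η : ℂ} (hη : ‖η‖ = 1)
      (h : ∀ m : ℕ, a (-(m + 1)) = η * (u (m + 1) * a (m + 1))) (i : ℕ) :
      toeplitzGram a 0 i = toeplitzGram (fun n => u (-n) * a (-n)) 0 i ↔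
        (η - conj η) * ∑ k ∈ Finset.range (i + 1), p (i - k) * conj (u k * p k) +
          conj (a 0) * (η - 1) * p i - a 0 * (conj η - 1) * conj (u i * p i) = 0 := by
    have hηη : conj η * η = 1 := by rw [Complex.conj_mul', hη]; norm_num
    rw [toeplitzGram_zero ha, toeplitzGram_zero hb]
    -- Both indices are negative, so the relation introduces conj η · η = 1 and the tails coincide.
    have htail (k : ℕ) : conj (a (-((k + i + 1 : ℕ) : ℤ))) * a (-((k + 1 : ℕ) : ℤ)) =
        conj (u (- -((k + i + 1 : ℕ) : ℤ)) * a (- -((k + i + 1 : ℕ) : ℤ))) *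
          (u (- -((k + 1 : ℕ) : ℤ)) * a (- -((k + 1 : ℕ) : ℤ))) := by
      have h1 := h (k + i)
      have h2 := h k
      push_cast at h1 h2 ⊢
      simp only [neg_neg]
      rw [h1, h2]
      simp only [map_mul]
      linear_combination (conj (u (k + i + 1)) * conj (a (k + i + 1)) *
        (u (k + 1) * a (k + 1))) * hηη
    rw [tsum_congr htail, add_left_inj]
    -- For i = 0 the end terms k = 0 and k = i coincide and both sides hold trivially. For i = n + 1
    -- they carry a 0, and the n middle terms give the convolution, with factor conj η for a and η
    -- for b.
    rcases i with _ | n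
    · simp only [zero_add, Finset.sum_range_one, Nat.cast_zero, neg_zero, sub_zero, hp, map_mul]
      simp only [hu0, lt_irrefl, if_false, map_zero, map_one, one_mul, mul_zero, add_zero, sub_zero]
    · have hmid1 : ∑ k ∈ Finset.range n,
          conj (a (-((k + 1 : ℕ) : ℤ))) * a ((n + 1 : ℕ) - (k + 1 : ℕ)) =
            conj η * ∑ k ∈ Finset.range n, a (n - k) * conj (u (k + 1) * a (k + 1)) := by
        rw [Finset.mul_sum]
        refine Finset.sum_congr rfl fun k _ => ?_
        push_cast
        rw [h k, add_sub_add_right_eq_sub]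
        simp only [map_mul]
        ring
      have hmid2 : ∑ k ∈ Finset.range n,
          conj (u (- -((k + 1 : ℕ) : ℤ)) * a (- -((k + 1 : ℕ) : ℤ))) *
            (u (-(((n + 1 : ℕ) : ℤ) - (k + 1 : ℕ))) * a (-(((n + 1 : ℕ) : ℤ) - (k + 1 : ℕ)))) =
            η * ∑ k ∈ Finset.range n, a (n - k) * conj (u (k + 1) * a (k + 1)) := by
        rw [Finset.mul_sum]
        refine Finset.sum_congr rfl fun k hk => ?_
        obtain ⟨l, rfl⟩ := Nat.exists_eq_add_of_lt (Finset.mem_range.1 hk)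
        have h1 := (key η l).1 (h l)
        have e1 : ((k + l + 1 + 1 : ℕ) : ℤ) - (k + 1 : ℕ) = l + 1 := by push_cast; ring
        have e2 : ((k + l + 1 : ℕ) : ℤ) - k = l + 1 := by push_cast; ring
        rw [e1, e2, h1, neg_neg]
        push_cast
        ring
      have hmid3 : ∑ k ∈ Finset.range n,
          p ((n + 1 : ℕ) - (k + 1 : ℕ)) * conj (u (k + 1 : ℕ) * p (k + 1 : ℕ)) =
            ∑ k ∈ Finset.range n, a (n - k) * conj (u (k + 1) * a (k + 1)) := by
        refine Finset.sum_congr rfl fun k hk => ?_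
        have hk := Finset.mem_range.1 hk
        rw [hp, hp, if_pos (by omega), if_pos (by omega)]
        push_cast
        rw [add_sub_add_right_eq_sub]
      simp only [Finset.sum_range_succ _ (n + 1), Finset.sum_range_succ' _ n, hmid1, hmid2, hmid3]
      have hp0 : p 0 = 0 := by rw [hp, if_neg (lt_irrefl _)]
      have hpn : p (n + 1) = a (n + 1) := by rw [hp, if_pos (by omega)]
      have h1 := h n
      have h2 := (key η n).1 h1
      push_cast
      simp only [neg_zero, neg_neg, sub_zero, sub_self, hu0, hp0, hpn]
      rw [h2, h1]
      simp only [map_mul, map_zero, map_one, mul_zero, zero_mul, add_zero]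
      constructor <;> intro h3
      · linear_combination -h3
      · linear_combination -h3
  rw [toeplitzGram_eq_iff ha hb]
  constructor
  · rintro ⟨h1, h2⟩
    obtain ⟨η, hη, h3⟩ := exists_unimodular_of_conj_mul_eq
      (x := fun i : ℕ => a (i + 1)) (y := fun i : ℕ => u (-(i + 1)) * a (-(i + 1))) h1
    have h4 (m : ℕ) := (key η m).2 (h3 m)
    exact ⟨η, hη, h4, fun i => (main hη h4 i).1 (h2 i)⟩
  · rintro ⟨η, hη, h1, h2⟩
    refine ⟨fun i j => ?_, fun i => (main hη h1 i).2 (h2 i)⟩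
    have hηη : conj η * η = 1 := by rw [Complex.conj_mul', hη]; norm_num
    rw [(key η i).1 (h1 i), (key η j).1 (h1 j), map_mul]
    linear_combination -(conj (a (i + 1)) * a (j + 1)) * hηη

/-! ### Fourier coefficients: uniqueness in L¹ and convolution -/

section FourierCoeff

variable {T : ℝ} [hT : Fact (0 < T)]

/-- Integration against f is a bounded functional on continuous functions that kills the characters,
whose span is uniformly dense. -/
theorem integral_mul_eq_zero_of_fourierCoeff_eq_zero {f : AddCircle T → ℂ}
    (hf : Integrable f haarAddCircle) (h : ∀ n, fourierCoeff f n = 0) (g : C(AddCircle T, ℂ)) :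
    ∫ t, g t * f t ∂haarAddCircle = 0 := by
  have hint (g : C(AddCircle T, ℂ)) : Integrable (fun t => g t * f t) haarAddCircle :=
    hf.bdd_mul (c := ‖g‖) g.continuous.aestronglyMeasurable
      (Filter.Eventually.of_forall g.norm_coe_le_norm)
  let Φ : C(AddCircle T, ℂ) →L[ℂ] ℂ := LinearMap.mkContinuous
    { toFun := fun g => ∫ t, g t * f t ∂haarAddCircle
      map_add' := fun g k => by
        rw [← integral_add (hint g) (hint k)]
        simp only [ContinuousMap.add_apply, add_mul]
      map_smul' := fun c g => by
        simp only [ContinuousMap.smul_apply, smul_eq_mul, mul_assoc, integral_const_mul,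
          RingHom.id_apply] }
    (∫ t, ‖f t‖ ∂haarAddCircle) fun g => by
      change ‖∫ t, g t * f t ∂haarAddCircle‖ ≤ _
      rw [mul_comm, ← integral_const_mul]
      refine norm_integral_le_of_norm_le (hf.norm.const_mul _)
        (Filter.Eventually.of_forall fun t => ?_)
      rw [norm_mul]
      exact mul_le_mul_of_nonneg_right (g.norm_coe_le_norm t) (norm_nonneg _)
  have hΦ : Φ = 0 := by
    refine ContinuousLinearMap.ext_on (s := Set.range (@fourier T)) ?_ ?_
    · exact Submodule.dense_iff_topologicalClosure_eq_top.2 span_fourier_closure_eq_top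
    · rintro _ ⟨n, rfl⟩
      have := h (-n)
      rw [fourierCoeff, neg_neg] at this
      exact this
  exact congrArg (fun Ψ => Ψ g) hΦ

/-- An integrable function on the circle whose Fourier coefficients all vanish is zero. -/
theorem ae_eq_zero_of_fourierCoeff_eq_zero {f : AddCircle T → ℂ}
    (hf : Integrable f haarAddCircle) (h : ∀ n, fourierCoeff f n = 0) :
    f =ᵐ[haarAddCircle] 0 := by
  refine ae_eq_zero_of_forall_setIntegral_isClosed_eq_zero hf fun s hs => ?_
  -- Continuous functions bounded by 1 and tending pointwise to the indicator of s, for dominated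
  -- convergence.
  let g (n : ℕ) : C(AddCircle T, ℂ) :=
    ⟨fun t => ((hs.apprSeq n t : ℝ) : ℂ), by fun_prop⟩
  have hz (n : ℕ) : ∫ t, g n t * f t ∂haarAddCircle = 0 :=
    integral_mul_eq_zero_of_fourierCoeff_eq_zero hf h (g n)
  rw [← integral_indicator hs.measurableSet]
  refine tendsto_nhds_unique (f := fun n => ∫ t, g n t * f t ∂haarAddCircle) (l := Filter.atTop)
    ?_ (by simp only [hz]; exact tendsto_const_nhds)
  refine tendsto_integral_of_dominated_convergence (fun t => ‖f t‖) (fun n => ?_) hf.norm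
    (fun n => Filter.Eventually.of_forall fun t => ?_) (Filter.Eventually.of_forall fun t => ?_)
  · exact (g n).continuous.aestronglyMeasurable.mul hf.aestronglyMeasurable
  · rw [norm_mul]
    refine mul_le_of_le_one_left (norm_nonneg _) ?_
    have := HasOuterApproxClosed.apprSeq_apply_le_one hs n t
    simpa [g] using this
  · have h1 := (tendsto_pi_nhds.1 (HasOuterApproxClosed.tendsto_apprSeq hs) t)
    have h2 : Filter.Tendsto (fun n => g n t) Filter.atTop
        (nhds (((s.indicator (fun _ => (1 : NNReal)) t : NNReal) : ℝ) : ℂ)) :=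
      ((Complex.continuous_ofReal.comp NNReal.continuous_coe).tendsto _).comp h1
    convert h2.mul_const (f t) using 2
    by_cases ht : t ∈ s <;> simp [ht]

theorem ae_eq_iff_fourierCoeff_eq {f g : AddCircle T → ℂ}
    (hf : Integrable f haarAddCircle) (hg : Integrable g haarAddCircle) :
    f =ᵐ[haarAddCircle] g ↔ ∀ n, fourierCoeff f n = fourierCoeff g n := by
  refine ⟨fun h n => congrFun (fourierCoeff_congr_ae h) n, fun h => ?_⟩
  have h0 : f + (fun t => (-1) * g t) =ᵐ[haarAddCircle] 0 :=
    ae_eq_zero_of_fourierCoeff_eq_zero (hf.add (hg.const_mul _)) fun n => by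
      rw [fourierCoeff.add hf (hg.const_mul _), Pi.add_apply, fourierCoeff.const_mul, h n]
      ring
  filter_upwards [h0] with t ht
  simp only [Pi.add_apply, Pi.zero_apply] at ht
  linear_combination ht

theorem fourierCoeff_conj (f : AddCircle T → ℂ) (n : ℤ) :
    fourierCoeff (fun t => conj (f t)) n = conj (fourierCoeff f (-n)) := by
  rw [fourierCoeff, fourierCoeff, ← integral_conj]
  refine integral_congr_ae (Filter.Eventually.of_forall fun t => ?_)
  simp only [smul_eq_mul, map_mul, ← fourier_neg, neg_neg]

theorem inner_fourierLp (f : Lp ℂ 2 (@haarAddCircle T hT)) (n : ℤ) :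
    ⟪(fourierLp 2 n : Lp ℂ 2 (@haarAddCircle T hT)), f⟫_ℂ = fourierCoeff f n := by
  rw [← fourierBasis_repr, HilbertBasis.repr_apply_apply, coe_fourierBasis]

theorem fourierCoeff_fourierLp (m n : ℤ) :
    fourierCoeff (fourierLp 2 m : Lp ℂ 2 (@haarAddCircle T hT)) n = if n = m then 1 else 0 := by
  rw [← inner_fourierLp]
  exact orthonormal_iff_ite.1 orthonormal_fourier n m

/-- The Fourier coefficients of a product of two `L²` functions are given by convolution. -/
theorem hasSum_fourierCoeff_mul (f g : Lp ℂ 2 (@haarAddCircle T hT)) (n : ℤ) :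
    HasSum (fun k => fourierCoeff f (n - k) * fourierCoeff g k)
      (fourierCoeff (fun t => f t * g t) n) := by
  -- The inner product of z^n conj f with g is the n-th coefficient of fg, so Parseval applied to
  -- this pair gives the convolution.
  have hx : MemLp (fun t => fourier n t * conj (f t)) 2 (@haarAddCircle T hT) := by
    refine (Lp.memLp f).of_le ?_ (Filter.Eventually.of_forall fun t => ?_)
    · exact (fourier n).continuous.aestronglyMeasurable.mul
        (Complex.continuous_conj.comp_aestronglyMeasurable (Lp.aestronglyMeasurable f))
    · rw [norm_mul, RCLike.norm_conj, fourier_apply, Circle.norm_coe, one_mul]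
  have hxg (g : Lp ℂ 2 (@haarAddCircle T hT)) :
      ⟪hx.toLp, g⟫_ℂ = fourierCoeff (fun t => f t * g t) n := by
    rw [L2.inner_def, fourierCoeff]
    refine integral_congr_ae ?_
    filter_upwards [hx.coeFn_toLp] with t ht
    rw [ht, RCLike.inner_apply, map_mul, Complex.conj_conj, ← fourier_neg, smul_eq_mul]
    ring
  have h := fourierBasis.hasSum_inner_mul_inner hx.toLp g
  rw [hxg] at h
  refine h.congr_fun fun k => ?_
  rw [coe_fourierBasis, inner_fourierLp, hxg]
  congr 1
  refine integral_congr_ae ?_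
  filter_upwards [coeFn_fourierLp 2 k] with t ht
  simp only [smul_eq_mul]
  rw [ht, neg_sub, sub_eq_add_neg, fourier_add]
  ring

end FourierCoeff

/-! ### Coefficients of φ₋ and φ₊ -/

theorem fourierCoeff_minusPart (φ : LinfTorus) (n : ℤ) :
    fourierCoeff (minusPart φ) n = if n < 0 then fourierCoeff φ n else 0 := by
  rw [← inner_fourierLp]
  refine ((hasSum_minusPart φ).mapL (innerSL ℂ (fourierLp 2 n))).unique ?_
  simp only [innerSL_apply_apply, inner_smul_right, inner_fourierLp, fourierCoeff_fourierLp]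
  split_ifs with hn
  · obtain ⟨m, rfl⟩ : ∃ m : ℕ, n = -((m + 1 : ℕ) : ℤ) := ⟨(-n - 1).toNat, by omega⟩
    convert hasSum_single m fun k hk => ?_ using 1
    · simp
    · rw [if_neg (by omega), mul_zero]
  · convert hasSum_zero using 2 with k
    rw [if_neg (by omega), mul_zero]

theorem fourierCoeff_plusPart (φ : LinfTorus) (n : ℤ) :
    fourierCoeff (plusPart φ : L2Torus) n = if 0 < n then fourierCoeff φ n else 0 := by
  rw [← inner_fourierLp]
  refine (((hasSum_plusPart φ).mapL Hardy.subtypeL).mapL (innerSL ℂ (fourierLp 2 n))).unique ?_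
  simp only [innerSL_apply_apply, map_smul, inner_fourierLp,
    Submodule.subtypeL_apply, hardyMonomial, fourierCoeff_fourierLp]
  split_ifs with hn
  · obtain ⟨m, rfl⟩ : ∃ m : ℕ, n = ((m + 1 : ℕ) : ℤ) := ⟨(n - 1).toNat, by omega⟩
    convert hasSum_single m fun k hk => ?_ using 1
    · simp
    · rw [if_neg (by omega), smul_zero]
  · convert hasSum_zero using 2 with k
    rw [if_neg (by omega), smul_zero]

/-! ### Matrix form of antilinear normality -/

section AntilinearAdjoint

variable {H : Type*} [NormedAddCommGroup H] [InnerProductSpace ℂ H] [CompleteSpace H]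

theorem inner_antilinearAdjoint_right (X : H →L⋆[ℂ] H) (x y : H) :
    ⟪x, antilinearAdjoint X y⟫_ℂ = ⟪y, X x⟫_ℂ := by
  rw [inner_antilinearAdjoint X x y, inner_conj_symm]

/-- A bounded antilinear operator commutes with its antilinear adjoint if and only if the matrix
entries of the two products with respect to a Hilbert basis agree. -/
theorem comp_antilinearAdjoint_eq_iff {ι : Type*} (b : HilbertBasis ι ℂ H) (X : H →L⋆[ℂ] H) :
    X.comp (antilinearAdjoint X) = (antilinearAdjoint X).comp X ↔
      ∀ i j, ∑' k, conj ⟪b i, X (b k)⟫_ℂ * ⟪b j, X (b k)⟫_ℂ =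
        ∑' k, conj ⟪b k, X (b i)⟫_ℂ * ⟪b k, X (b j)⟫_ℂ := by
  -- The entries of X X♯ and X♯ X are ⟪X♯ b i, X♯ b j⟫ and ⟪X b i, X b j⟫; Parseval expands both.
  have h1 (i j : ι) : ∑' k, conj ⟪b i, X (b k)⟫_ℂ * ⟪b j, X (b k)⟫_ℂ =
      ⟪b j, X (antilinearAdjoint X (b i))⟫_ℂ := by
    rw [← inner_antilinearAdjoint_right, ← b.tsum_inner_mul_inner]
    refine tsum_congr fun k => ?_
    rw [← inner_antilinearAdjoint_right, inner_conj_symm, inner_antilinearAdjoint_right]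
  have h2 (i j : ι) : ∑' k, conj ⟪b k, X (b i)⟫_ℂ * ⟪b k, X (b j)⟫_ℂ =
      ⟪b j, antilinearAdjoint X (X (b i))⟫_ℂ := by
    rw [inner_antilinearAdjoint_right, ← b.tsum_inner_mul_inner]
    refine tsum_congr fun k => ?_
    rw [inner_conj_symm]
  simp only [h1, h2]
  constructor
  · intro h i j
    exact congrArg (fun Y => ⟪b j, Y (b i)⟫_ℂ) h
  · intro h
    refine ContinuousLinearMap.ext_on (s := Set.range b) ?_ ?_
    · exact Submodule.dense_iff_topologicalClosure_eq_top.2 b.dense_span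
    · rintro _ ⟨i, rfl⟩
      refine b.repr.injective (lp.ext (funext fun j => ?_))
      rw [b.repr_apply_apply, b.repr_apply_apply]
      exact h i j

end AntilinearAdjoint

/-! ### Monomial basis of H² and the matrix of T_φ C -/

theorem inner_hardyMonomial (f : Hardy) (n : ℕ) :
    ⟪hardyMonomial n, f⟫_ℂ = fourierCoeff (f : L2Torus) n :=
  inner_fourierLp (f : L2Torus) n

theorem Hardy.fourierCoeff_smul (c : ℂ) (f : Hardy) (n : ℤ) :
    fourierCoeff ((c • f : Hardy) : L2Torus) n = c * fourierCoeff (f : L2Torus) n := by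
  rw [← inner_fourierLp, ← inner_fourierLp]
  exact inner_smul_right (𝕜 := ℂ) (E := L2Torus) _ _ _

theorem Hardy.ext_fourierCoeff {f g : Hardy}
    (h : ∀ n : ℕ, fourierCoeff (f : L2Torus) n = fourierCoeff (g : L2Torus) n) : f = g := by
  refine Subtype.ext (fourierBasis.repr.injective (lp.ext (funext fun n => ?_)))
  rw [fourierBasis_repr, fourierBasis_repr]
  rcases lt_or_ge n 0 with hn | hn
  · rw [f.2 n hn, g.2 n hn]
  · lift n to ℕ using hn
    exact h n

theorem orthonormal_hardyMonomial : Orthonormal ℂ hardyMonomial := by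
  refine orthonormal_iff_ite.2 fun i j => ?_
  rw [inner_hardyMonomial, hardyMonomial, fourierCoeff_fourierLp]
  simp

/-- The monomials form a Hilbert basis of `H²`. -/
noncomputable def hardyBasis : HilbertBasis ℕ ℂ Hardy :=
  HilbertBasis.mkOfOrthogonalEqBot orthonormal_hardyMonomial <| by
    refine (Submodule.eq_bot_iff _).2 fun f hf => Hardy.ext_fourierCoeff fun n => ?_
    rw [← inner_hardyMonomial, ← inner_hardyMonomial, inner_zero_right]
    exact (Submodule.mem_orthogonal _ _).1 hf _ (Submodule.subset_span ⟨n, rfl⟩)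

theorem hardyBasis_apply (n : ℕ) : hardyBasis n = hardyMonomial n :=
  congrFun (HilbertBasis.coe_mkOfOrthogonalEqBot _ _) n

theorem hardyConj_hardyMonomial (ξ θ : ℝ) (k : ℕ) :
    hardyConj ξ θ (hardyMonomial k) =
      (Complex.exp (ξ * Complex.I) * conj (fourier k (θ : Torus))) • hardyMonomial k := by
  refine Hardy.ext_fourierCoeff fun n => ?_
  rw [Hardy.fourierCoeff_smul, coe_hardyConj, fourierCoeff_conjFun, hardyMonomial,
    fourierCoeff_fourierLp]
  split_ifs with h
  · rw [h, map_one]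
  · simp

theorem inner_toeplitz_hardyMonomial (φ : LinfTorus) (i k : ℕ) :
    ⟪hardyMonomial i, toeplitz φ (hardyMonomial k)⟫_ℂ = fourierCoeff φ (i - k) := by
  have h : ⟪hardyMonomial i, toeplitz φ (hardyMonomial k)⟫_ℂ =
      ⟪(fourierLp 2 (i : ℤ) : L2Torus), mulOp φ (fourierLp 2 (k : ℤ))⟫_ℂ :=
    Submodule.inner_orthogonalProjectionOnto_eq_of_mem_left (hardyMonomial i) _
  rw [h, inner_fourierLp]
  refine integral_congr_ae ?_
  filter_upwards [coeFn_mulOp φ (fourierLp 2 (k : ℤ)), coeFn_fourierLp 2 (k : ℤ)] with t h1 h2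
  rw [h1, h2, neg_sub, sub_eq_add_neg, fourier_add, smul_eq_mul, smul_eq_mul]
  ring

theorem summable_sq_fourierCoeff (φ : LinfTorus) : Summable fun n => ‖fourierCoeff φ n‖ ^ 2 := by
  have h := (hasSum_sq_fourierCoeff ((memLp_two_of_Linf φ).toLp φ)).summable
  rwa [fourierCoeff_congr_ae (memLp_two_of_Linf φ).coeFn_toLp] at h

theorem conj_fourier_mul_fourier {T : ℝ} (n : ℤ) (t : AddCircle T) :
    conj (fourier n t) * fourier n t = 1 := by
  rw [Complex.conj_mul', fourier_apply, Circle.norm_coe]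
  norm_num

theorem inner_toeplitz_hardyConj (ξ θ : ℝ) (φ : LinfTorus) (i k : ℕ) :
    ⟪hardyMonomial i, (toeplitz φ).comp (hardyConj ξ θ).toCLM (hardyMonomial k)⟫_ℂ =
      Complex.exp (ξ * Complex.I) * conj (fourier k (θ : Torus)) * fourierCoeff φ (i - k) := by
  rw [ContinuousLinearMap.comp_apply, hardyConj_hardyMonomial, map_smul, inner_hardyMonomial,
    Hardy.fourierCoeff_smul, ← inner_hardyMonomial, inner_toeplitz_hardyMonomial]

/-- `C_{ξ,θ}`-normality of `T_φ` in terms of the Fourier coefficients of `φ`. -/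
theorem isCNormal_toeplitz_iff (ξ θ : ℝ) (φ : LinfTorus) :
    IsCNormal (hardyConj ξ θ) (toeplitz φ) ↔ ∀ i j : ℕ,
      toeplitzGram (fourierCoeff φ) i j =
        toeplitzGram (fun n => fourier (-n) (θ : Torus) * fourierCoeff φ (-n)) i j := by
  rw [IsCNormal, comp_antilinearAdjoint_eq_iff hardyBasis]
  simp only [hardyBasis_apply, inner_toeplitz_hardyConj, toeplitzGram]
  have hξ := conj_exp_mul_exp ξ
  refine forall_congr' fun i => forall_congr' fun j => ?_
  refine Eq.congr (tsum_congr fun k => ?_) (tsum_congr fun k => ?_)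
  -- Here the unimodular weight of column k cancels against its conjugate.
  · have h := conj_fourier_mul_fourier k (θ : Torus)
    simp only [map_mul, Complex.conj_conj]
    linear_combination (conj (fourierCoeff φ (i - k)) * fourierCoeff φ (j - k)) *
      (conj (fourier k (θ : Torus)) * fourier k (θ : Torus) * hξ + h)
  -- Here the weight is u i · conj (u j), independent of k; it factors as u (i - k) · u (k - j), the
  -- twist in the reflected sequence.
  · have h := conj_fourier_mul_fourier k (θ : Torus)
    simp only [neg_sub, sub_eq_add_neg (k : ℤ), fourier_add, fourier_neg, map_mul,
      Complex.conj_conj]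
    linear_combination (fourier i (θ : Torus) * conj (fourier j (θ : Torus)) *
      conj (fourierCoeff φ (k + -i)) * fourierCoeff φ (k + -j)) * (hξ - h)

/-! ### From coefficient identities to equations between functions -/

/-- The convolution is finite: terms with k < 0 vanish through g, those with k > n through f. -/
theorem fourierCoeff_mul_Hardy (f g : Hardy) (n : ℕ) :
    fourierCoeff (fun t => (f : L2Torus) t * (g : L2Torus) t) n =
      ∑ k ∈ Finset.range (n + 1),
        fourierCoeff (f : L2Torus) (n - k) * fourierCoeff (g : L2Torus) k := by
  have h := hasSum_fourierCoeff_mul (f : L2Torus) (g : L2Torus) n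
  rw [← Function.Injective.hasSum_iff (Nat.cast_injective (R := ℤ))] at h
  · refine h.unique (hasSum_sum_of_ne_finset_zero fun k hk => ?_)
    rw [Function.comp_apply, f.2 _ (by simp at hk; omega), zero_mul]
  · intro k hk
    rw [g.2 k (not_le.1 fun h0 => hk ⟨k.toNat, Int.toNat_of_nonneg h0⟩), mul_zero]

theorem fourierCoeff_mul_Hardy_of_neg (f g : Hardy) {n : ℤ} (hn : n < 0) :
    fourierCoeff (fun t => (f : L2Torus) t * (g : L2Torus) t) n = 0 := by
  refine (hasSum_fourierCoeff_mul (f : L2Torus) (g : L2Torus) n).unique ?_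
  convert hasSum_zero using 2 with k
  rcases lt_or_ge k 0 with hk | hk
  · rw [g.2 k hk, mul_zero]
  · rw [f.2 (n - k) (by omega), zero_mul]

theorem integrable_L2Torus (f : L2Torus) : Integrable f haarAddCircle :=
  (Lp.memLp f).integrable one_le_two

theorem integrable_mul_L2Torus (f g : L2Torus) : Integrable (fun t => f t * g t) haarAddCircle :=
  (Lp.memLp f).integrable_mul (Lp.memLp g)

/-- The left side is integrable with vanishing negative coefficients, so only n ≥ 0 imposes
conditions. -/
theorem ae_mul_add_eq_zero_iff (f g : Hardy) (A B D : ℂ) :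
    (∀ᵐ t ∂(haarAddCircle : Measure Torus),
      A * ((f : L2Torus) t * (g : L2Torus) t) + B * (f : L2Torus) t + D * (g : L2Torus) t = 0) ↔
    ∀ n : ℕ, A * ∑ k ∈ Finset.range (n + 1),
        fourierCoeff (f : L2Torus) (n - k) * fourierCoeff (g : L2Torus) k +
      B * fourierCoeff (f : L2Torus) n + D * fourierCoeff (g : L2Torus) n = 0 := by
  have h1 := (integrable_mul_L2Torus f g).const_mul A
  have h2 := (integrable_L2Torus f).const_mul B
  have h3 := (integrable_L2Torus g).const_mul D
  have hc (n : ℤ) : fourierCoeff (fun t => A * ((f : L2Torus) t * (g : L2Torus) t) +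
      B * (f : L2Torus) t + D * (g : L2Torus) t) n =
      A * fourierCoeff (fun t => (f : L2Torus) t * (g : L2Torus) t) n +
        B * fourierCoeff (f : L2Torus) n + D * fourierCoeff (g : L2Torus) n := by
    rw [← fourierCoeff.const_mul, ← fourierCoeff.const_mul, ← fourierCoeff.const_mul]
    have e1 := congrFun (fourierCoeff.add h1 h2) n
    have e2 := congrFun (fourierCoeff.add (h1.add h2) h3) n
    rw [Pi.add_apply] at e1 e2
    rw [← e1]
    exact e2
  have h0 (n : ℤ) : fourierCoeff (0 : Torus → ℂ) n = 0 := by simp [fourierCoeff]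
  refine (ae_eq_iff_fourierCoeff_eq ((h1.add h2).add h3) (integrable_zero _ _ _)).trans ?_
  refine (forall_congr' fun n => Eq.congr (hc n) (h0 n)).trans ?_
  constructor
  · intro h n
    rw [← fourierCoeff_mul_Hardy]
    exact h n
  · intro h n
    rcases lt_or_ge n 0 with hn | hn
    · rw [fourierCoeff_mul_Hardy_of_neg f g hn, f.2 n hn, g.2 n hn]
      ring
    · lift n to ℕ using hn
      rw [fourierCoeff_mul_Hardy]
      exact h n

theorem minusPart_ae_eq_iff (ξ θ : ℝ) (φ : LinfTorus) (η : ℂ) :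
    (∀ᵐ t ∂(haarAddCircle : Measure Torus), minusPart φ t = η * Complex.exp (ξ * Complex.I) *
      conj ((hardyConj ξ θ (plusPart φ) : L2Torus) t)) ↔
    ∀ m : ℕ, fourierCoeff φ (-(m + 1)) =
      η * (fourier (m + 1) (θ : Torus) * fourierCoeff φ (m + 1)) := by
  have hint : Integrable (fun t => conj ((hardyConj ξ θ (plusPart φ) : L2Torus) t))
      haarAddCircle :=
    Complex.conjCLE.toContinuousLinearMap.integrable_comp (integrable_L2Torus _)
  refine (ae_eq_iff_fourierCoeff_eq (integrable_L2Torus _) (hint.const_mul _)).trans ?_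
  have hξ := conj_exp_mul_exp ξ
  have hc (n : ℤ) : fourierCoeff (fun t => η * Complex.exp (ξ * Complex.I) *
      conj ((hardyConj ξ θ (plusPart φ) : L2Torus) t)) n =
      if n < 0 then η * (fourier (-n) (θ : Torus) * fourierCoeff φ (-n)) else 0 := by
    rw [fourierCoeff.const_mul, fourierCoeff_conj, coe_hardyConj, fourierCoeff_conjFun,
      fourierCoeff_plusPart]
    simp only [Left.neg_pos_iff]
    split_ifs
    · simp only [map_mul, Complex.conj_conj]
      linear_combination η * fourier (-n) (θ : Torus) * fourierCoeff φ (-n) * hξ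
    · simp
  simp only [hc, fourierCoeff_minusPart]
  constructor
  · intro h m
    have := h (-(m + 1))
    rwa [if_pos (by omega), if_pos (by omega), neg_neg] at this
  · intro h n
    split_ifs with hn
    · obtain ⟨m, rfl⟩ : ∃ m : ℕ, n = -((m : ℤ) + 1) := ⟨(-n - 1).toNat, by omega⟩
      rw [neg_neg]
      exact h m
    · rfl

theorem mainTheorem1 (ξ θ : ℝ) (φ : LinfTorus) :
    IsCNormal (hardyConj ξ θ) (toeplitz φ) ↔
      ∃ η : ℂ, ‖η‖ = 1 ∧
        (∀ᵐ t ∂(haarAddCircle : Measure Torus),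
          minusPart φ t =
            η * Complex.exp (ξ * Complex.I) *
              conj ((hardyConj ξ θ (plusPart φ) : L2Torus) t)) ∧
        (∀ᵐ t ∂(haarAddCircle : Measure Torus),
          (η - conj η) * (plusPart φ : L2Torus) t * (hardyConj ξ θ (plusPart φ) : L2Torus) t
            + conj (fourierCoeff φ 0) * (η - 1) * Complex.exp (ξ * Complex.I) *
                (plusPart φ : L2Torus) t
            - fourierCoeff φ 0 * (conj η - 1) * (hardyConj ξ θ (plusPart φ) : L2Torus) t = 0) := by
  rw [isCNormal_toeplitz_iff,
    toeplitzGram_twist_eq_iff (summable_sq_fourierCoeff φ)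
      (u := fun n => fourier n (θ : Torus)) fourier_zero (fun n => ?_) (fun n => ?_)
      (fourierCoeff_plusPart φ)]
  · refine exists_congr fun η => and_congr_right fun _ => and_congr
      (minusPart_ae_eq_iff ξ θ φ η).symm ?_
    have h := ae_mul_add_eq_zero_iff (plusPart φ) (hardyConj ξ θ (plusPart φ)) (η - conj η)
      (conj (fourierCoeff φ 0) * (η - 1) * Complex.exp (ξ * Complex.I))
      (-(fourierCoeff φ 0 * (conj η - 1)))
    refine Iff.trans ?_ (h.symm.trans (Filter.eventually_congr
      (Filter.Eventually.of_forall fun t => ?_)))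
    · refine forall_congr' fun i => ?_
      simp only [coe_hardyConj, fourierCoeff_conjFun]
      -- Each occurrence of Cφ₊ carries a factor e^{iξ} absent from the sequence identity; the φ₊
      -- term has it explicitly.
      rw [← mul_right_inj' (Complex.exp_ne_zero (ξ * Complex.I)), mul_zero]
      refine Eq.congr_left ?_
      have hs : ∑ k ∈ Finset.range (i + 1), fourierCoeff (plusPart φ : L2Torus) (i - k) *
          (Complex.exp (ξ * Complex.I) * conj (fourier k (θ : Torus)) *
            conj (fourierCoeff (plusPart φ : L2Torus) k)) =
          Complex.exp (ξ * Complex.I) * ∑ k ∈ Finset.range (i + 1),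
            fourierCoeff (plusPart φ : L2Torus) (i - k) *
              conj (fourier k (θ : Torus) * fourierCoeff (plusPart φ : L2Torus) k) := by
        rw [Finset.mul_sum]
        refine Finset.sum_congr rfl fun k _ => ?_
        rw [map_mul]
        ring
      rw [hs, map_mul]
      ring
    · refine Eq.congr_left ?_
      ring
  · rw [fourier_neg, conj_fourier_mul_fourier]
  · rw [fourier_apply, Circle.norm_coe]
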